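/- There is an absolute constant $c>0$ such that the following holds. Let $G=(V,E)$ be a connected undirected graph on $n\ge 2$ vertices, and let $P$ be the transition matrix of a discrete-time Markov chain on $G$ (so $P_{u,v}=0$ whenever $u\ne v$ and $\{u,v\}\notin E$) that is lazy ($P_{u,u}\ge 1/2$ for all $u$), irreducible, and reversible with respect to its stationary distribution $\pi$ ($\pi(u)P_{u,v}=\pi(v)P_{v,u}$ for all $u,v$). Put $\sigma=\max_{u,v\in V}\pi(v)/\pi(u)$ and, for $\epsilon>0$, $$t_{mix}(\epsilon)=\min\Bigl\{t\in\mathbb N:\ \tfrac12\sum_{v\in V}\bigl|(P^t)_{u,v}-\pi(v)\bigr|\le\epsilon\ \text{ for all }u\in V\Bigr\}.$$ Consider local search on $G$: given oracle access to an unknown function $f:V\to\mathbb R$ (a query names a vertex $v$ and returns $f(v)$), find a vertex $v$ with $f(v)\le f(w)$ for all neighbours $w$ of $v$. Its randomized query complexity $R(G)$ is the infimum, over all randomized algorithms (probability distributions over deterministic adaptive query algorithms) that on every input $f$ output a local minimum with probability at least $9/10$, of the maximum over inputs $f$ of the expected number of queries. Then $$R(G)\ \ge\ c\cdot\frac{\sqrt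 n}{\max\{1,\,t_{mix}(\sigma/(2n))\}\cdot\exp(3\sigma)}.$$ In particular, $R(G)=\Omega\bigl(\sqrt n/(t_{mix}(\sigma/(2n))\exp(3\sigma))\bigr)$ whenever $t_{mix}(\sigma/(2n))\ge 1$. -/

import Mathlib

open MeasureTheory
open scoped ENNReal Matrix

universe u

namespace LocalSearch

/-! ### Local search and its randomized query complexity -/

/-- `v` is a local minimum of `f` on `G`: `f v ≤ f w` for every neighbour `w` of `v`. -/
def IsLocalMinimum {V : Type u} (G : SimpleGraph V) (f : V → ℝ) (v : V) : Prop :=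
  ∀ w, G.Adj v w → f v ≤ f w

/-- A deterministic query algorithm with oracle access to an unknown function `f : V → ℝ`, as a
(real-branching) decision tree: either it stops and outputs a vertex, or it asks for the value of
`f` at a vertex `v` and continues with the tree that belongs to the answer `f v`. -/
inductive QueryAlgorithm (V : Type u) : Type u
  | output (v : V) : QueryAlgorithm V
  | query (v : V) (next : ℝ → QueryAlgorithm V) : QueryAlgorithm V

namespace QueryAlgorithm

variable {V : Type u}

/-- The vertex that the algorithm outputs on input `f`. -/
def result (f : V → ℝ) : QueryAlgorithm V → V
  | output v => v
  | query v next => result f (next (f v))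

/-- The number of queries that the algorithm makes on input `f`. -/
def numQueries (f : V → ℝ) : QueryAlgorithm V → ℕ
  | output _ => 0
  | query v next => numQueries f (next (f v)) + 1

/-- The coarsest σ-algebra for which, on every input, the output and the number of queries are
random variables (with values in a discrete space). -/
instance : MeasurableSpace (QueryAlgorithm V) :=
  ⨆ f : V → ℝ, MeasurableSpace.comap (fun A => (result f A, numQueries f A)) ⊤

end QueryAlgorithm

/-- A randomized algorithm is a probability distribution over deterministic algorithms. It solves
local search on `G` if on every input `f` it outputs a local minimum of `f` with probability at
least `9/10`. -/
def Solves {V : Type u} (G : SimpleGraph V) (μ : ProbabilityMeasure (QueryAlgorithm V)) : Prop :=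
  ∀ f : V → ℝ, (9 / 10 : ℝ≥0∞) ≤
    (μ : Measure (QueryAlgorithm V)) {A | IsLocalMinimum G f (A.result f)}

/-- The expected number of queries of a randomized algorithm on a worst-case input. -/
noncomputable def expectedQueries {V : Type u} (μ : ProbabilityMeasure (QueryAlgorithm V)) :
    ℝ≥0∞ :=
  ⨆ f : V → ℝ, ∫⁻ A, (A.numQueries f : ℝ≥0∞) ∂(μ : Measure (QueryAlgorithm V))

/-- The randomized query complexity of local search on `G`: the least (infimum) worst-case
expected number of queries of a randomized algorithm that, on every input, finds a local minimum
with probability at least `9/10`. -/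
noncomputable def randomizedQueryComplexity {V : Type u} (G : SimpleGraph V) : ℝ≥0∞ :=
  ⨅ (μ : ProbabilityMeasure (QueryAlgorithm V)) (_ : Solves G μ), expectedQueries μ

/-! ### Markov chains on a graph -/

section Chain

variable {V : Type u} [Fintype V] [DecidableEq V]

/-- `P` is the transition matrix of a discrete-time Markov chain on `G`: it is row-stochastic and
its transitions are along edges of `G` or stay in place. -/
def IsChainOn (G : SimpleGraph V) (P : Matrix V V ℝ) : Prop :=
  P ∈ Matrix.rowStochastic ℝ V ∧ ∀ u v, u ≠ v → ¬ G.Adj u v → P u v = 0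

/-- `p` is a stationary probability distribution of `P`. -/
def IsStationaryDistribution (P : Matrix V V ℝ) (p : V → ℝ) : Prop :=
  p ∈ stdSimplex ℝ V ∧ p ᵥ* P = p

/-- The chain stays in place with probability at least `1/2`. -/
def IsLazy (P : Matrix V V ℝ) : Prop :=
  ∀ u, 1 / 2 ≤ P u u

/-- Every state can be reached from every state. -/
def IsIrreducibleChain (P : Matrix V V ℝ) : Prop :=
  ∀ u v, ∃ t : ℕ, 0 < (P ^ t) u v

/-- Detailed balance with respect to `p`. -/
def IsReversible (P : Matrix V V ℝ) (p : V → ℝ) : Prop :=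
  ∀ u v, p u * P u v = p v * P v u

/-- The mixing time: the least `t` such that, from every starting state, the total variation
distance between the distribution after `t` steps and `p` is at most `ε`. -/
noncomputable def mixingTime (P : Matrix V V ℝ) (p : V → ℝ) (ε : ℝ) : ℕ :=
  sInf {t : ℕ | ∀ u, 1 / 2 * ∑ v, |(P ^ t) u v - p v| ≤ ε}

/-- `σ = max_{u,v} p v / p u`. -/
noncomputable def maxRatio (p : V → ℝ) : ℝ :=
  ⨆ x : V × V, p x.2 / p x.1

end Chain

end LocalSearch

/-! The hard inputs come from the chain itself. Run it from a fixed vertex for `m * T` steps, `T`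
being the mixing time (at least 1). The `staircase` of the trajectory equals the distance to the
start off the trajectory and decreases along it by time of last visit, so its only local minimum is
the endpoint (`eq_current_of_isLocalMinimum`). Resample the walk after a milestone time `j * T`. The
two trajectories are exchangeable and their endpoints rarely coincide, so an algorithm correct on
both usually gives different outputs, and must then query, on both inputs, a vertex of one of the
resampled tails. By symmetry, with probability about 1/2 it queries on one input a vertex of the
other, unseen tail (`half_le_walkExp`). Given the first trajectory, that tail visits a vertex `a`
with probability at most the sum of `(P ^ (s + 1)) (position o x (j * T)) a` over its steps. Summing
over the `m` milestones shows what one query is worth (`milestones_le`). Steps beyond `T` after a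
milestone contribute at most `β = 2σ/n` each, by mixing. For the first `T` steps, if the milestones
are distinct, reversibility bounds the sum over milestones by `σ` per step (`sum_pow_apply_le`). So
a query is worth at most `T (σ + m²β)` while about `m/2` is needed. Milestones collide with
probability at most `m²β`, so `m ≈ √(n/σ)` is affordable and gives order `√n / (T σ²)` queries;
finally `σ² ≤ exp (3σ)`. -/

namespace LocalSearch

/-! ### Mixing and reversibility of the chain -/

section Chain

variable {V : Type u} [Fintype V] [DecidableEq V] {P : Matrix V V ℝ} {p : V → ℝ}

/-- Right multiplication by a stochastic matrix with entries at least `δ` contracts the `ℓ¹` norm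
of row vectors of total mass zero. -/
theorem sum_abs_vecMul_le {Q : Matrix V V ℝ} {δ : ℝ} (hQ : Q ∈ Matrix.rowStochastic ℝ V)
    (hδ : ∀ u v, δ ≤ Q u v) (d : V → ℝ) (hd : ∑ u, d u = 0) :
    ∑ v, |(d ᵥ* Q) v| ≤ (1 - Fintype.card V * δ) * ∑ u, |d u| := by
  have h1 : ∀ v, |(d ᵥ* Q) v| ≤ ∑ u, |d u| * (Q u v - δ) := by
    intro v
    -- Since `d` has mass zero, subtracting the constant `δ` from every entry of `Q` changes
    -- nothing.
    have h2 : (d ᵥ* Q) v = ∑ u, d u * (Q u v - δ) := by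
      simp only [Matrix.vecMul, dotProduct, mul_sub, Finset.sum_sub_distrib, ← Finset.sum_mul, hd]
      ring
    rw [h2]
    refine (Finset.abs_sum_le_sum_abs _ _).trans (Finset.sum_le_sum fun u _ => ?_)
    rw [abs_mul, abs_of_nonneg (sub_nonneg.2 (hδ u v))]
  refine (Finset.sum_le_sum fun v _ => h1 v).trans (le_of_eq ?_)
  rw [Finset.sum_comm, Finset.mul_sum]
  refine Finset.sum_congr rfl fun u _ => ?_
  rw [← Finset.mul_sum, Finset.sum_sub_distrib, Matrix.sum_row_of_mem_rowStochastic hQ]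
  simp [mul_comm]

/-- Laziness lets the chain wait at its target, so positivity persists in time and any common upper
bound of the hitting exponents works; their sum is one. -/
theorem exists_pow_pos (hP : P ∈ Matrix.rowStochastic ℝ V) (hlazy : IsLazy P)
    (hirr : IsIrreducibleChain P) : ∃ t : ℕ, ∀ u v, 0 < (P ^ t) u v := by
  choose t ht using hirr
  have step : ∀ u v s, 0 < (P ^ s) u v → 0 < (P ^ (s + 1)) u v := by
    intro u v s hs
    rw [pow_succ, Matrix.mul_apply]
    have h0 : 0 < P v v := lt_of_lt_of_le (by norm_num) (hlazy v)
    refine lt_of_lt_of_le (mul_pos hs h0)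
      (Finset.single_le_sum (f := fun w => (P ^ s) u w * P w v) (fun w _ => ?_)
        (Finset.mem_univ v))
    exact mul_nonneg (Matrix.nonneg_of_mem_rowStochastic (pow_mem hP s))
      (Matrix.nonneg_of_mem_rowStochastic hP)
  refine ⟨∑ u, ∑ v, t u v, fun u v => ?_⟩
  have hle : t u v ≤ ∑ u, ∑ v, t u v :=
    (Finset.single_le_sum (f := fun v => t u v) (fun _ _ => Nat.zero_le _)
      (Finset.mem_univ v)).trans
      (Finset.single_le_sum (f := fun u => ∑ v, t u v) (fun _ _ => Nat.zero_le _)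
        (Finset.mem_univ u))
  exact Nat.le_induction (ht u v) (fun s _ hs => step u v s hs) _ hle

theorem vecMul_pow_eq (hp : p ᵥ* P = p) (t : ℕ) : p ᵥ* P ^ t = p := by
  induction t with
  | zero => simp
  | succ t ih => rw [pow_succ, ← Matrix.vecMul_vecMul, ih, hp]

/-- A lazy irreducible finite chain converges to its stationary distribution in total variation,
uniformly in the starting state. -/
theorem exists_totalVariation_le [Nonempty V] (hP : P ∈ Matrix.rowStochastic ℝ V)
    (hp : IsStationaryDistribution P p) (hlazy : IsLazy P) (hirr : IsIrreducibleChain P)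
    {ε : ℝ} (hε : 0 < ε) : ∃ t : ℕ, ∀ u, 1 / 2 * ∑ v, |(P ^ t) u v - p v| ≤ ε := by
  obtain ⟨t, ht⟩ := exists_pow_pos hP hlazy hirr
  obtain ⟨x, -, hx⟩ := Finset.exists_min_image (Finset.univ : Finset (V × V))
    (fun x => (P ^ t) x.1 x.2) Finset.univ_nonempty
  set δ := (P ^ t) x.1 x.2 with hδ
  have hδ0 : 0 < δ := ht _ _
  have hδle : ∀ u v, δ ≤ (P ^ t) u v := fun u v => hx (u, v) (Finset.mem_univ _)
  have hPt := pow_mem hP t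
  set r : ℝ := 1 - Fintype.card V * δ with hr
  have hr1 : r < 1 := by
    have : (0 : ℝ) < Fintype.card V := by exact_mod_cast Fintype.card_pos
    have := mul_pos this hδ0
    linarith
  have hr0 : 0 ≤ r := by
    have h1 : ∑ v : V, δ ≤ ∑ v, (P ^ t) x.1 v := Finset.sum_le_sum fun v _ => hδle _ v
    rw [Matrix.sum_row_of_mem_rowStochastic hPt] at h1
    simp at h1
    linarith
  have key : ∀ u k, ∑ v, |(P ^ (t * k)) u v - p v| ≤ r ^ k * 2 := by
    intro u k
    induction k with
    | zero =>
      simp only [mul_zero, pow_zero, one_mul]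
      calc ∑ v, |(1 : Matrix V V ℝ) u v - p v|
          ≤ ∑ v, ((1 : Matrix V V ℝ) u v + p v) := by
            refine Finset.sum_le_sum fun v _ => ?_
            have h1 : 0 ≤ (1 : Matrix V V ℝ) u v := by
              rw [Matrix.one_apply]; split_ifs <;> norm_num
            have h2 := hp.1.1 v
            rw [abs_le]; constructor <;> linarith
        _ = 2 := by
            rw [Finset.sum_add_distrib, hp.1.2,
              Matrix.sum_row_of_mem_rowStochastic (one_mem (Matrix.rowStochastic ℝ V))]
            norm_num
    | succ k ih =>
      have h1 : ∀ v, (P ^ (t * (k + 1))) u v - p v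
          = ((fun w => (P ^ (t * k)) u w - p w) ᵥ* P ^ t) v := by
        intro v
        have h2 : (fun w => (P ^ (t * k)) u w - p w) = (P ^ (t * k)) u - p := rfl
        rw [h2, Matrix.sub_vecMul, vecMul_pow_eq hp.2, mul_add, mul_one, pow_add]
        rfl
      simp_rw [h1]
      refine (sum_abs_vecMul_le hPt hδle _ ?_).trans ?_
      · rw [Finset.sum_sub_distrib, hp.1.2, Matrix.sum_row_of_mem_rowStochastic (pow_mem hP _),
          sub_self]
      · rw [pow_succ, mul_comm (r ^ k), mul_assoc]
        exact mul_le_mul_of_nonneg_left ih hr0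
  obtain ⟨k, hk⟩ := exists_pow_lt_of_lt_one hε hr1
  refine ⟨t * k, fun u => ?_⟩
  have := key u k
  linarith

theorem stationary_pos (hP : P ∈ Matrix.rowStochastic ℝ V) (hp : IsStationaryDistribution P p)
    (hirr : IsIrreducibleChain P) (v : V) : 0 < p v := by
  obtain ⟨u, hu⟩ : ∃ u, 0 < p u := by
    by_contra! h
    have : ∑ u, p u ≤ 0 := Finset.sum_nonpos fun u _ => h u
    rw [hp.1.2] at this
    linarith
  obtain ⟨t, ht⟩ := hirr u v
  rw [← vecMul_pow_eq hp.2 t]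
  refine lt_of_lt_of_le (mul_pos hu ht) (Finset.single_le_sum
    (f := fun w => p w * (P ^ t) w v) (fun w _ => ?_) (Finset.mem_univ u))
  exact mul_nonneg (hp.1.1 w) (Matrix.nonneg_of_mem_rowStochastic (pow_mem hP t))

omit [DecidableEq V] in
theorem div_le_maxRatio (u v : V) : p v / p u ≤ maxRatio p :=
  le_ciSup (f := fun x : V × V => p x.2 / p x.1) (Set.finite_range _).bddAbove (u, v)

omit [DecidableEq V] in
theorem le_maxRatio_mul (hp : ∀ v, 0 < p v) (u v : V) : p v ≤ maxRatio p * p u :=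
  (div_le_iff₀ (hp u)).1 (div_le_maxRatio u v)

omit [DecidableEq V] in
theorem one_le_maxRatio [Nonempty V] (hp : ∀ v, 0 < p v) : 1 ≤ maxRatio p := by
  have h := div_le_maxRatio (p := p) (Classical.arbitrary V) (Classical.arbitrary V)
  rwa [div_self (hp _).ne'] at h

omit [DecidableEq V] in
theorem le_maxRatio_div_card [Nonempty V] (hp : ∀ v, 0 < p v) (hs : ∑ v, p v = 1) (v : V) :
    p v ≤ maxRatio p / Fintype.card V := by
  rw [le_div_iff₀ (by exact_mod_cast Fintype.card_pos)]
  have h : ∑ u : V, p v ≤ ∑ u, maxRatio p * p u :=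
    Finset.sum_le_sum fun u _ => le_maxRatio_mul hp u v
  rw [← Finset.mul_sum, hs] at h
  simp at h
  linarith

/-- From the mixing time on, every transition probability is `O(σ / n)`. -/
theorem pow_apply_le_of_mixingTime_le [Nonempty V] (hP : P ∈ Matrix.rowStochastic ℝ V)
    (hp : IsStationaryDistribution P p) (hlazy : IsLazy P) (hirr : IsIrreducibleChain P) {s : ℕ}
    (hs : mixingTime P p (maxRatio p / (2 * (Fintype.card V : ℝ))) ≤ s) (u v : V) :
    (P ^ s) u v ≤ 2 * maxRatio p / Fintype.card V := by
  have hpos := stationary_pos hP hp hirr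
  have hn : (0 : ℝ) < Fintype.card V := by exact_mod_cast Fintype.card_pos
  have hσ : 0 < maxRatio p := lt_of_lt_of_le one_pos (one_le_maxRatio hpos)
  -- Convergence makes the set nonempty, so the infimum is attained and is not the default value 0.
  have hmix := Nat.sInf_mem (s := {t : ℕ | ∀ u, 1 / 2 * ∑ v, |(P ^ t) u v - p v|
      ≤ maxRatio p / (2 * (Fintype.card V : ℝ))})
    (exists_totalVariation_le hP hp hlazy hirr (by positivity))
  change ∀ u, 1 / 2 * ∑ v, |(P ^ (mixingTime P p _)) u v - p v| ≤ _ at hmix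
  set t := mixingTime P p (maxRatio p / (2 * (Fintype.card V : ℝ)))
  have h1 : ∀ w, (P ^ t) w v ≤ 2 * maxRatio p / Fintype.card V := by
    intro w
    have h2 : |(P ^ t) w v - p v| ≤ ∑ v, |(P ^ t) w v - p v| :=
      Finset.single_le_sum (f := fun v => |(P ^ t) w v - p v|) (fun _ _ => abs_nonneg _)
        (Finset.mem_univ v)
    have h3 := hmix w
    have h4 := le_maxRatio_div_card hpos hp.1.2 v
    have h5 := le_abs_self ((P ^ t) w v - p v)
    have h6 : maxRatio p / (2 * (Fintype.card V : ℝ)) = maxRatio p / Fintype.card V / 2 := by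
      field_simp
    have h7 : 2 * maxRatio p / (Fintype.card V : ℝ) = 2 * (maxRatio p / Fintype.card V) := by
      ring
    rw [h7]
    rw [h6] at h3
    linarith
  -- Later powers average the rows of `P ^ t`, so the entrywise bound persists.
  obtain ⟨r, rfl⟩ := Nat.exists_eq_add_of_le' hs
  rw [pow_add, Matrix.mul_apply]
  calc ∑ w, (P ^ r) u w * (P ^ t) w v
      ≤ ∑ w, (P ^ r) u w * (2 * maxRatio p / Fintype.card V) :=
        Finset.sum_le_sum fun w _ => mul_le_mul_of_nonneg_left (h1 w)
          (Matrix.nonneg_of_mem_rowStochastic (pow_mem hP r))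
    _ = _ := by
        rw [← Finset.sum_mul, Matrix.sum_row_of_mem_rowStochastic (pow_mem hP r), one_mul]

theorem IsReversible.pow (h : IsReversible P p) (t : ℕ) : IsReversible (P ^ t) p := by
  induction t with
  | zero =>
    intro u v
    by_cases huv : u = v
    · rw [huv]
    · simp [Matrix.one_apply_ne huv, Matrix.one_apply_ne (Ne.symm huv)]
  | succ t ih =>
    intro u v
    rw [pow_succ, Matrix.mul_apply, ← pow_succ, pow_succ', Matrix.mul_apply, Finset.mul_sum,
      Finset.mul_sum]
    refine Finset.sum_congr rfl fun w _ => ?_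
    rw [← mul_assoc, ih u w, mul_right_comm, h w v]
    ring

/-- For a reversible chain, the probabilities to hit `a` after `s` steps from distinct starting
states add up to at most `σ`. -/
theorem sum_pow_apply_le (hP : P ∈ Matrix.rowStochastic ℝ V) (hp : ∀ v, 0 < p v)
    (hrev : IsReversible P p) (s : ℕ) (a : V) (S : Finset V) :
    ∑ u ∈ S, (P ^ s) u a ≤ maxRatio p := by
  have hnn : ∀ u v, 0 ≤ (P ^ s) u v := fun u v =>
    Matrix.nonneg_of_mem_rowStochastic (pow_mem hP s)
  have hσ : 0 ≤ maxRatio p := (div_pos (hp a) (hp a)).le.trans (div_le_maxRatio a a)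
  -- Reversing time turns a column sum into a row sum, which is at most 1, at the cost of the factor
  -- `p a / p u ≤ σ`.
  calc ∑ u ∈ S, (P ^ s) u a ≤ ∑ u ∈ S, maxRatio p * (P ^ s) a u := by
        refine Finset.sum_le_sum fun u _ => ?_
        refine le_of_mul_le_mul_left ?_ (hp u)
        rw [hrev.pow s u a, ← mul_assoc, mul_comm (p u)]
        exact mul_le_mul_of_nonneg_right (le_maxRatio_mul hp u a) (hnn a u)
    _ ≤ ∑ u, maxRatio p * (P ^ s) a u :=
        Finset.sum_le_sum_of_subset_of_nonneg (Finset.subset_univ _) fun u _ _ =>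
          mul_nonneg hσ (hnn a u)
    _ = maxRatio p := by
        rw [← Finset.mul_sum, Matrix.sum_row_of_mem_rowStochastic (pow_mem hP s), mul_one]

end Chain

/-! ### Random walks and their staircase functions -/

section Walk

variable {V : Type u}

/-- The current vertex of a walk from `o`; a walk is recorded as the list of the vertices visited
after `o`, the latest one first. -/
def current (o : V) (h : List V) : V := h.headD o

/-- The vertex of the walk `h` from `o` at time `s`. -/
def position (o : V) (h : List V) (s : ℕ) : V := current o (h.drop (h.length - s))

/-- All transitions of the walk have positive probability. -/
def IsPossible (P : Matrix V V ℝ) (o : V) : List V → Prop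
  | [] => True
  | v :: h => 0 < P (current o h) v ∧ IsPossible P o h

/-- The expectation of `g` over `k` further steps of the chain after the walk `h` from `o`. -/
noncomputable def walkExp [Fintype V] (P : Matrix V V ℝ) (o : V) :
    ℕ → List V → (List V → ℝ) → ℝ
  | 0, h, g => g h
  | k + 1, h, g => ∑ v, P (current o h) v * walkExp P o k (v :: h) g

theorem position_append (o : V) (t h : List V) {s : ℕ} (hs : s ≤ h.length) :
    position o (t ++ h) s = position o h s := by
  unfold position
  congr 1
  rw [List.length_append, Nat.add_sub_assoc hs, List.drop_append]
  simp

theorem position_length (o : V) (h : List V) : position o h h.length = current o h := by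
  simp [position]

variable [Fintype V] {P : Matrix V V ℝ} {o : V}

theorem walkExp_add (i k : ℕ) (h : List V) (g : List V → ℝ) :
    walkExp P o (i + k) h g = walkExp P o i h fun h' => walkExp P o k h' g := by
  induction i generalizing h with
  | zero => simp [walkExp]
  | succ i ih =>
    rw [Nat.add_right_comm]
    simp only [walkExp, ih]

theorem walkExp_fun_add (k : ℕ) (h : List V) (g g' : List V → ℝ) :
    walkExp P o k h (fun x => g x + g' x) = walkExp P o k h g + walkExp P o k h g' := by
  induction k generalizing h with
  | zero => rfl
  | succ k ih => simp only [walkExp, ih, mul_add, Finset.sum_add_distrib]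

theorem walkExp_const_mul (k : ℕ) (h : List V) (c : ℝ) (g : List V → ℝ) :
    walkExp P o k h (fun x => c * g x) = c * walkExp P o k h g := by
  induction k generalizing h with
  | zero => rfl
  | succ k ih =>
    simp only [walkExp, ih, Finset.mul_sum]
    exact Finset.sum_congr rfl fun v _ => by ring

theorem walkExp_sum {ι : Type*} (s : Finset ι) (k : ℕ) (h : List V) (g : ι → List V → ℝ) :
    walkExp P o k h (fun x => ∑ i ∈ s, g i x) = ∑ i ∈ s, walkExp P o k h (g i) := by
  induction k generalizing h with
  | zero => rfl
  | succ k ih =>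
    simp only [walkExp, ih, Finset.mul_sum]
    exact Finset.sum_comm

theorem walkExp_list_sum {α : Type*} (l : List α) (k : ℕ) (h : List V) (g : α → List V → ℝ) :
    walkExp P o k h (fun x => (l.map fun a => g a x).sum)
      = (l.map fun a => walkExp P o k h (g a)).sum := by
  induction l with
  | nil => simpa using walkExp_const_mul (P := P) (o := o) k h 0 (fun _ => 0)
  | cons a l ih => simp only [List.map_cons, List.sum_cons, walkExp_fun_add, ih]

/-- Fubini for two independent walks; this supplies the exchangeability in the resampling argument.
-/
theorem walkExp_comm (k k' : ℕ) (h h' : List V) (g : List V → List V → ℝ) :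
    walkExp P o k h (fun x => walkExp P o k' h' fun y => g x y)
      = walkExp P o k' h' (fun y => walkExp P o k h fun x => g x y) := by
  induction k generalizing h with
  | zero => rfl
  | succ k ih => simp only [walkExp, ih, walkExp_sum, walkExp_const_mul]

variable [DecidableEq V]

theorem walkExp_const (hP : P ∈ Matrix.rowStochastic ℝ V) (k : ℕ) (h : List V) (c : ℝ) :
    walkExp P o k h (fun _ => c) = c := by
  induction k generalizing h with
  | zero => rfl
  | succ k ih =>
    simp only [walkExp, ih, ← Finset.sum_mul, Matrix.sum_row_of_mem_rowStochastic hP, one_mul]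

theorem walkExp_mono (hP : P ∈ Matrix.rowStochastic ℝ V) {k : ℕ} {h : List V}
    {g g' : List V → ℝ} (hh : IsPossible P o h)
    (H : ∀ t : List V, t.length = k → IsPossible P o (t ++ h) → g (t ++ h) ≤ g' (t ++ h)) :
    walkExp P o k h g ≤ walkExp P o k h g' := by
  induction k generalizing h with
  | zero => exact H [] rfl hh
  | succ k ih =>
    refine Finset.sum_le_sum fun v _ => ?_
    rcases (Matrix.nonneg_of_mem_rowStochastic hP : 0 ≤ P (current o h) v).eq_or_lt with h0 | h0
    · simp [← h0]
    · refine mul_le_mul_of_nonneg_left (ih ⟨h0, hh⟩ fun t ht hp => ?_) h0.le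
      have := H (t ++ [v]) (by simp [ht]) (by simpa using hp)
      simpa using this

theorem walkExp_congr (hP : P ∈ Matrix.rowStochastic ℝ V) {k : ℕ} {h : List V}
    {g g' : List V → ℝ} (hh : IsPossible P o h)
    (H : ∀ t : List V, t.length = k → IsPossible P o (t ++ h) → g (t ++ h) = g' (t ++ h)) :
    walkExp P o k h g = walkExp P o k h g' :=
  le_antisymm (walkExp_mono hP hh fun t ht hp => (H t ht hp).le)
    (walkExp_mono hP hh fun t ht hp => (H t ht hp).ge)

theorem walkExp_current (k : ℕ) (h : List V) (a : V) :
    walkExp P o k h (fun x => if current o x = a then 1 else 0) = (P ^ k) (current o h) a := by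
  induction k generalizing h with
  | zero => simp [walkExp, Matrix.one_apply]
  | succ k ih => simp only [walkExp, ih, pow_succ', Matrix.mul_apply]; rfl

/-- Union bound over the `k` new steps, which `take k` selects because the latest vertex comes
first. -/
theorem walkExp_mem_le (hP : P ∈ Matrix.rowStochastic ℝ V) (k : ℕ) {h : List V}
    (hh : IsPossible P o h) (a : V) :
    walkExp P o k h (fun x => if a ∈ x.take k then 1 else 0)
      ≤ ∑ s ∈ Finset.range k, (P ^ (s + 1)) (current o h) a := by
  induction k generalizing h with
  | zero => simp [walkExp]
  | succ k ih =>
    have h1 : ∀ v, P (current o h) v *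
        walkExp P o k (v :: h) (fun x => if a ∈ x.take (k + 1) then 1 else 0) ≤
        P (current o h) v * ((if v = a then 1 else 0)
          + ∑ s ∈ Finset.range k, (P ^ (s + 1)) v a) := by
      intro v
      rcases (Matrix.nonneg_of_mem_rowStochastic hP : 0 ≤ P (current o h) v).eq_or_lt with h0 | h0
      · simp [← h0]
      · refine mul_le_mul_of_nonneg_left ?_ h0.le
        refine le_trans ?_ (add_le_add_right (ih (h := v :: h) ⟨h0, hh⟩) _)
        rw [← walkExp_const (o := o) hP k (v :: h) (if v = a then 1 else 0), ← walkExp_fun_add]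
        refine walkExp_mono hP ⟨h0, hh⟩ fun t ht _ => ?_
        subst ht
        have e1 : (t ++ v :: h).take (t.length + 1) = t ++ [v] := by
          simp [List.take_append]
        have e2 : (t ++ v :: h).take t.length = t := by simp
        rw [e1, e2]
        by_cases h1 : a ∈ t <;> by_cases h2 : v = a <;> grind
    refine (Finset.sum_le_sum fun v _ => h1 v).trans (le_of_eq ?_)
    simp only [mul_add, Finset.sum_add_distrib, Finset.mul_sum]
    rw [Finset.sum_comm, Finset.sum_range_succ' (n := k), add_comm]
    congr 1
    · refine Finset.sum_congr rfl fun s _ => ?_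
      rw [pow_succ' P (s + 1), Matrix.mul_apply]
    · simp

/-- A bound for the probability that the walk is at the same place at two distant times. -/
theorem walkExp_position_eq_le (hP : P ∈ Matrix.rowStochastic ℝ V) {L b c : ℕ} (hbc : b ≤ c)
    (hc : c ≤ L) {β : ℝ} (hβ : ∀ u, (P ^ (c - b)) u u ≤ β) :
    walkExp P o L [] (fun x => if position o x b = position o x c then 1 else 0) ≤ β := by
  obtain ⟨r, rfl⟩ := Nat.exists_eq_add_of_le hc
  obtain ⟨d, rfl⟩ := Nat.exists_eq_add_of_le hbc
  rw [Nat.add_sub_cancel_left] at hβ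
  -- Split at times `b` and `c`: given the walk up to `b`, the event is a return after `c - b`
  -- steps, and the steps after `c` are irrelevant.
  rw [walkExp_add, walkExp_add]
  rw [← walkExp_const (P := P) (o := o) hP b [] β]
  refine walkExp_mono hP trivial fun t ht hp => ?_
  rw [List.append_nil] at hp ⊢
  refine le_trans (le_of_eq ?_) (hβ (current o t))
  rw [← walkExp_current]
  refine walkExp_congr hP hp fun t' ht' hp' => ?_
  rw [← walkExp_const (P := P) (o := o) hP r (t' ++ t)
    (if current o (t' ++ t) = current o t then 1 else 0)]
  refine walkExp_congr hP hp' fun t'' _ _ => ?_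
  have h2 : (t' ++ t).length = b + d := by simp [ht, ht', add_comm]
  rw [position_append _ _ _ (by omega), position_append _ _ _ (by omega),
    position_append _ _ _ (by omega), ← ht, position_length, ht, ← h2, position_length]
  simp only [eq_comm]

/-- The value at the vertices of a walk decreases with the time of the last visit; elsewhere it is
the distance from the start `o`. -/
noncomputable def staircase (G : SimpleGraph V) (o : V) : List V → V → ℝ
  | [], a => G.dist o a
  | v :: h, a => if a = v then -(h.length + 1) else staircase G o h a

omit [Fintype V] in
theorem neg_length_le_staircase (G : SimpleGraph V) (h : List V) (a : V) :
    -(h.length : ℝ) ≤ staircase G o h a := by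
  induction h with
  | nil => simp [staircase]
  | cons v h ih =>
    simp only [staircase, List.length_cons]
    push_cast
    split_ifs <;> linarith

omit [Fintype V] in
theorem staircase_current (G : SimpleGraph V) (h : List V) :
    staircase G o h (current o h) = -(h.length : ℝ) := by
  cases h <;> simp [staircase, current]

omit [Fintype V] in
theorem staircase_append_of_notMem (G : SimpleGraph V) {t : List V} (h : List V) {a : V}
    (ha : a ∉ t) : staircase G o (t ++ h) a = staircase G o h a := by
  induction t with
  | nil => rfl
  | cons v t ih =>
    rw [List.mem_cons, not_or] at ha
    rw [List.cons_append, staircase, if_neg ha.1, ih ha.2]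

omit [Fintype V] [DecidableEq V] in
theorem exists_adj_dist_lt {G : SimpleGraph V} (hG : G.Connected) {a : V} (ha : a ≠ o) :
    ∃ b, G.Adj a b ∧ G.dist o b < G.dist o a := by
  obtain ⟨w, hw⟩ := hG.exists_walk_length_eq_dist a o
  cases w with
  | nil => exact absurd rfl ha
  | cons hadj w =>
    refine ⟨_, hadj, ?_⟩
    rw [SimpleGraph.dist_comm (v := a), ← hw, SimpleGraph.Walk.length_cons, SimpleGraph.dist_comm]
    exact Nat.lt_succ_of_le (SimpleGraph.dist_le w)

/-- The end of a possible walk is the only local minimum of its staircase function. -/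
theorem eq_current_of_isLocalMinimum {G : SimpleGraph V} (hG : G.Connected)
    (hP : IsChainOn G P) {h : List V} (hh : IsPossible P o h) {a : V}
    (ha : IsLocalMinimum G (staircase G o h) a) : a = current o h := by
  by_contra hne
  suffices H : ∃ b, G.Adj a b ∧ staircase G o h b < staircase G o h a by
    obtain ⟨b, hb, hlt⟩ := H
    exact absurd (ha b hb) (not_le.2 hlt)
  clear ha
  induction h with
  | nil =>
    obtain ⟨b, hb, hlt⟩ := exists_adj_dist_lt (o := o) hG hne
    exact ⟨b, hb, by simpa [staircase] using hlt⟩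
  | cons v h ih =>
    have hav : a ≠ v := hne
    by_cases hac : a = current o h
    · refine ⟨v, ?_, ?_⟩
      · by_contra hadj
        rw [hac] at hadj hav
        exact hh.1.ne' (hP.2 _ _ hav hadj)
      · simp only [staircase, if_true, if_neg hav]
        rw [hac, staircase_current]
        linarith
    · obtain ⟨b, hb, hlt⟩ := ih hh.2 hac
      -- The new step only lowers values: if `b = v`, it receives a new minimum, so the old descent
      -- from `a` survives.
      refine ⟨b, hb, lt_of_le_of_lt ?_ (hlt.trans_eq ?_)⟩
      · simp only [staircase]
        split_ifs
        · have := neg_length_le_staircase (o := o) G h b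
          linarith
        · exact le_rfl
      · simp only [staircase, if_neg hav]

end Walk

/-! ### Decision trees -/

namespace QueryAlgorithm

variable {V : Type u}

/-- The vertices that the algorithm queries on input `f`. -/
def queried (f : V → ℝ) : QueryAlgorithm V → List V
  | output _ => []
  | query v next => v :: queried f (next (f v))

theorem length_queried (f : V → ℝ) (A : QueryAlgorithm V) :
    (A.queried f).length = A.numQueries f := by
  induction A with
  | output v => rfl
  | query v next ih => simp [queried, numQueries, ih]

/-- An algorithm can only distinguish two inputs by a query where they differ. -/
theorem exists_mem_queried (f g : V → ℝ) (A : QueryAlgorithm V) (h : A.result f ≠ A.result g) :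
    ∃ a, a ∈ A.queried f ∧ a ∈ A.queried g ∧ f a ≠ g a := by
  induction A with
  | output v => exact absurd rfl h
  | query v next ih =>
    by_cases hv : f v = g v
    · simp only [result, queried, hv] at h ⊢
      obtain ⟨a, ha, hb, hne⟩ := ih _ h
      exact ⟨a, List.mem_cons_of_mem _ ha, List.mem_cons_of_mem _ hb, hne⟩
    · exact ⟨v, by simp [queried], by simp [queried], hv⟩

theorem measurable_result_numQueries (f : V → ℝ) :
    @Measurable _ _ _ ⊤ fun A : QueryAlgorithm V => (A.result f, A.numQueries f) :=
  Measurable.of_comap_le (le_iSup (fun f : V → ℝ => MeasurableSpace.comap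
    (fun A : QueryAlgorithm V => (result f A, numQueries f A)) ⊤) f)

theorem measurableSet_result (f : V → ℝ) (S : Set V) :
    MeasurableSet {A : QueryAlgorithm V | A.result f ∈ S} :=
  measurable_result_numQueries f (t := {x | x.1 ∈ S}) trivial

theorem measurable_numQueries (f : V → ℝ) :
    Measurable fun A : QueryAlgorithm V => A.numQueries f := fun S _ =>
  measurable_result_numQueries f (t := {x | x.2 ∈ S}) trivial

end QueryAlgorithm

theorem sum_list_map_sum_le {ι α : Type*} (s : Finset ι) (F : ι → α → ℝ) {C : ℝ} (l : List α)
    (h : ∀ a, ∑ i ∈ s, F i a ≤ C) : ∑ i ∈ s, (l.map (F i)).sum ≤ C * l.length := by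
  induction l with
  | nil => simp
  | cons a l ih =>
    simp only [List.map_cons, List.sum_cons, Finset.sum_add_distrib, List.length_cons]
    push_cast
    linarith [h a]

/-! ### The resampling argument for a deterministic algorithm -/

section Resampling

variable {V : Type u} [Fintype V] [DecidableEq V] {P : Matrix V V ℝ} {o : V}

/-- On the staircase function of the walk `x`, the output is not the end of the walk. -/
noncomputable def failure (G : SimpleGraph V) (o : V) (A : QueryAlgorithm V) (x : List V) : ℝ :=
  if A.result (staircase G o x) = current o x then 0 else 1

omit [Fintype V] in
/-- Two walks with a common initial segment are told apart only by a query that is located in one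
of the two remaining segments. -/
theorem one_le_of_common_start (G : SimpleGraph V) (A : QueryAlgorithm V) (B : List V → Prop)
    [DecidablePred B] (t t' h : List V) (Φ : List V → List V → ℝ)
    (hΦ : ∀ x y, Φ x y = (if B x then 1 else 0) + failure G o A x
      + 1 / 2 * (if current o y = current o x then 1 else 0)
      + if B x then 0 else ((A.queried (staircase G o x)).map
          fun a => if a ∈ y.take t.length then (1 : ℝ) else 0).sum)
    (ht : t'.length = t.length) : 1 ≤ Φ (t ++ h) (t' ++ h) + Φ (t' ++ h) (t ++ h) := by
  have hsum : ∀ (l : List V) (y : List V), 0 ≤ (l.map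
      fun a => if a ∈ y.take t.length then (1 : ℝ) else 0).sum := by
    intro l y
    refine List.sum_nonneg fun r hr => ?_
    obtain ⟨a, -, rfl⟩ := List.mem_map.1 hr
    split_ifs <;> norm_num
  have hone : ∀ (l : List V) (y : List V) (a : V), a ∈ l → a ∈ y.take t.length →
      1 ≤ (l.map fun a => if a ∈ y.take t.length then (1 : ℝ) else 0).sum := by
    intro l y a hal hay
    refine List.single_le_sum ?_ _ (List.mem_map.2 ⟨a, hal, by simp [hay]⟩)
    intro r hr
    obtain ⟨a, -, rfl⟩ := List.mem_map.1 hr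
    split_ifs <;> norm_num
  have hf : ∀ x, 0 ≤ failure G o A x := fun x => by unfold failure; split_ifs <;> norm_num
  have hnn : ∀ x y, 0 ≤ Φ x y := by
    intro x y
    rw [hΦ]
    have := hf x
    have := hsum (A.queried (staircase G o x)) y
    split_ifs <;> linarith
  have hΦB : ∀ x y, B x → 1 ≤ Φ x y := by
    intro x y hB
    rw [hΦ, if_pos hB, if_pos hB]
    have := hf x
    split_ifs <;> linarith
  have hΦf : ∀ x y, failure G o A x = 1 → 1 ≤ Φ x y := by
    intro x y hx
    rw [hΦ, hx]
    have := hsum (A.queried (staircase G o x)) y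
    split_ifs <;> linarith
  have hΦe : ∀ x y, current o y = current o x → 1 / 2 ≤ Φ x y := by
    intro x y hx
    rw [hΦ, if_pos hx]
    have := hf x
    have := hsum (A.queried (staircase G o x)) y
    split_ifs <;> linarith
  have hΦq : ∀ x y a, ¬ B x → a ∈ A.queried (staircase G o x) → a ∈ y.take t.length →
      1 ≤ Φ x y := by
    intro x y a hB hax hay
    rw [hΦ, if_neg hB, if_neg hB]
    have := hone _ _ a hax hay
    have := hf x
    split_ifs <;> linarith
  set x := t ++ h with hx
  set y := t' ++ h with hy
  have hxy := hnn x y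
  have hyx := hnn y x
  by_cases hBx : B x
  · linarith [hΦB x y hBx]
  by_cases hBy : B y
  · linarith [hΦB y x hBy]
  by_cases hwx : A.result (staircase G o x) = current o x
  swap
  · linarith [hΦf x y (if_neg hwx)]
  by_cases hwy : A.result (staircase G o y) = current o y
  swap
  · linarith [hΦf y x (if_neg hwy)]
  by_cases he : current o x = current o y
  · linarith [hΦe x y he.symm, hΦe y x he]
  rw [← hwx, ← hwy] at he
  obtain ⟨a, hax, hay, hne⟩ := A.exists_mem_queried _ _ he
  have hat : a ∈ t ∨ a ∈ t' := by
    by_contra! hcon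
    apply hne
    rw [hx, hy, staircase_append_of_notMem G h hcon.1, staircase_append_of_notMem G h hcon.2]
  rcases hat with hat | hat
  -- As `a` is queried on both inputs, the charge can go to the run on the walk whose own tail need
  -- not contain `a`.
  · linarith [hΦq y x a hBy hay (by simpa [hx] using hat)]
  · linarith [hΦq x y a hBx hax (by simpa [hy, ← ht] using hat)]

/-- Resampling the walk after time `i`: an algorithm that is right on most walks must query often
where the resampled part of the walk is likely to be. -/
theorem half_le_walkExp (hP : P ∈ Matrix.rowStochastic ℝ V) (G : SimpleGraph V)
    (A : QueryAlgorithm V) (B : List V → Prop) [DecidablePred B] (i k : ℕ) {β : ℝ}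
    (hβ : ∀ u v, (P ^ k) u v ≤ β) :
    1 / 2 ≤ walkExp P o (i + k) [] fun x => (if B x then 1 else 0) + failure G o A x
      + β / 2 + if B x then 0 else ((A.queried (staircase G o x)).map
        fun a => ∑ s ∈ Finset.range k, (P ^ (s + 1)) (position o x i) a).sum := by
  rw [walkExp_add, ← walkExp_const (P := P) (o := o) hP i [] (1 / 2)]
  refine walkExp_mono hP trivial fun h hi hh => ?_
  rw [List.append_nil] at hh ⊢
  -- `Φ x y` charges the run on `x` for queries in the tail of `y`. Equal endpoints are seen by both
  -- orders, hence the weight 1/2.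
  set Φ : List V → List V → ℝ := fun x y => (if B x then 1 else 0) + failure G o A x
      + 1 / 2 * (if current o y = current o x then 1 else 0)
      + if B x then 0 else ((A.queried (staircase G o x)).map
          fun a => if a ∈ y.take k then (1 : ℝ) else 0).sum with hΦ
  have h1 : 1 / 2 ≤ walkExp P o k h fun x => walkExp P o k h fun y => Φ x y := by
    have h2 : 1 ≤ walkExp P o k h fun x => walkExp P o k h fun y => (Φ x y + Φ y x) := by
      rw [← walkExp_const (P := P) (o := o) hP k h 1]
      refine walkExp_mono hP hh fun t ht _ => ?_
      rw [← walkExp_const (P := P) (o := o) hP k h 1]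
      refine walkExp_mono hP hh fun t' ht' _ => ?_
      subst ht
      exact one_le_of_common_start G A B t t' h Φ (fun _ _ => rfl) ht'
    simp only [walkExp_fun_add] at h2
    rw [walkExp_comm k k h h fun x y => Φ y x] at h2
    linarith
  refine h1.trans (walkExp_mono hP hh fun t ht _ => ?_)
  have hpos : position o (t ++ h) i = current o h := by
    rw [position_append _ _ _ hi.ge, ← hi, position_length]
  rw [hpos]
  simp only [hΦ, walkExp_fun_add, walkExp_const hP, walkExp_const_mul, walkExp_current]
  have h3 := hβ (current o h) (current o (t ++ h))
  refine add_le_add (by linarith) ?_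
  by_cases hB : B (t ++ h)
  · simp [hB, walkExp_const hP]
  · simp only [hB, if_false, walkExp_list_sum]
    exact List.sum_le_sum fun a _ => walkExp_mem_le hP k hh a

/-- A deterministic algorithm that is mostly right on the staircase functions of random walks with
`m` milestones at distance `T` makes many queries on average. -/
theorem milestones_le (hP : P ∈ Matrix.rowStochastic ℝ V) (G : SimpleGraph V)
    (A : QueryAlgorithm V) (m T : ℕ) {β σ : ℝ} (hβ0 : 0 ≤ β)
    (hβ : ∀ s, T ≤ s → ∀ u v, (P ^ s) u v ≤ β)
    (hσ : ∀ s a, ∀ S : Finset V, ∑ u ∈ S, (P ^ s) u a ≤ σ) :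
    m / 2 ≤ m * (m ^ 2 * β + β / 2) + m * walkExp P o (m * T) [] (failure G o A)
      + T * (σ + m ^ 2 * β) *
        walkExp P o (m * T) [] fun x => (A.numQueries (staircase G o x) : ℝ) := by
  classical
  -- The bad event: two milestones coincide. Off it, the column bound `hσ` applies to the set of
  -- milestones.
  set B : List V → Prop := fun x =>
    ¬ Set.InjOn (fun j => position o x (j * T)) (Finset.range m : Set ℕ) with hB
  set coll : List V → ℝ := fun x => ∑ c ∈ Finset.range m, ∑ b ∈ Finset.range c,
    if position o x (b * T) = position o x (c * T) then 1 else 0 with hcoll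
  have hcoll0 : ∀ x, 0 ≤ coll x := fun x => Finset.sum_nonneg fun c _ =>
    Finset.sum_nonneg fun b _ => by split_ifs <;> norm_num
  have hBcoll : ∀ x, (if B x then (1 : ℝ) else 0) ≤ coll x := by
    intro x
    split_ifs with hx
    swap
    · exact hcoll0 x
    have : ∃ c ∈ Finset.range m, ∃ b ∈ Finset.range c,
        position o x (b * T) = position o x (c * T) := by
      simp only [hB, Set.InjOn] at hx
      push Not at hx
      obtain ⟨b, hb, c, hc, he, hne⟩ := hx
      rcases lt_or_gt_of_ne hne with h | h
      · exact ⟨c, by simpa using hc, b, by simpa using h, he⟩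
      · exact ⟨b, by simpa using hb, c, by simpa using h, he.symm⟩
    obtain ⟨c, hc, b, hb, he⟩ := this
    refine le_trans ?_ (Finset.single_le_sum (f := fun c => ∑ b ∈ Finset.range c,
      if position o x (b * T) = position o x (c * T) then (1 : ℝ) else 0)
      (fun c _ => Finset.sum_nonneg fun b _ => by split_ifs <;> norm_num) hc)
    refine le_trans ?_ (Finset.single_le_sum (f := fun b =>
      if position o x (b * T) = position o x (c * T) then (1 : ℝ) else 0)
      (fun b _ => by split_ifs <;> norm_num) hb)
    simp [he]
  have hcollE : walkExp P o (m * T) [] coll ≤ m ^ 2 * β := by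
    simp only [hcoll, walkExp_sum]
    calc _ ≤ ∑ c ∈ Finset.range m, ∑ b ∈ Finset.range c, β := by
          refine Finset.sum_le_sum fun c hc => Finset.sum_le_sum fun b hb => ?_
          rw [Finset.mem_range] at hc hb
          refine walkExp_position_eq_le hP (Nat.mul_le_mul_right _ hb.le)
            (Nat.mul_le_mul_right _ hc.le) fun u => hβ _ ?_ u u
          rw [← Nat.sub_mul]
          exact Nat.le_mul_of_pos_left _ (Nat.sub_pos_of_lt hb)
      _ ≤ ∑ c ∈ Finset.range m, m * β := by
          refine Finset.sum_le_sum fun c hc => ?_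
          rw [Finset.sum_const, Finset.card_range, nsmul_eq_mul]
          refine mul_le_mul_of_nonneg_right ?_ hβ0
          exact_mod_cast (Finset.mem_range.1 hc).le
      _ = m ^ 2 * β := by simp; ring
  have hvisit : ∀ x, ¬ B x → ∀ a, ∑ j ∈ Finset.range m, ∑ s ∈ Finset.range ((m - j) * T),
      (P ^ (s + 1)) (position o x (j * T)) a ≤ T * (σ + m ^ 2 * β) := by
    intro x hx a
    calc ∑ j ∈ Finset.range m, ∑ s ∈ Finset.range ((m - j) * T),
          (P ^ (s + 1)) (position o x (j * T)) a
        ≤ ∑ j ∈ Finset.range m, (∑ s ∈ Finset.range T,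
            (P ^ (s + 1)) (position o x (j * T)) a + m * T * β) := by
          refine Finset.sum_le_sum fun j hj => ?_
          rw [Finset.mem_range] at hj
          obtain ⟨d, hd⟩ : ∃ d, m - j = d + 1 := ⟨m - j - 1, by omega⟩
          -- Separate the first `T` steps, still unmixed, from the remaining `d * T`, each bounded
          -- by `β`.
          rw [hd, Nat.add_mul, one_mul, add_comm, Finset.sum_range_add]
          refine add_le_add_right ?_ _
          calc _ ≤ ∑ s ∈ Finset.range (d * T), β :=
                Finset.sum_le_sum fun s _ => hβ _ (by omega) _ _
            _ = (d * T : ℕ) * β := by simp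
            _ ≤ m * T * β := by
                refine mul_le_mul_of_nonneg_right ?_ hβ0
                have : d * T ≤ m * T := Nat.mul_le_mul_right _ (by omega)
                exact_mod_cast this
      _ = ∑ s ∈ Finset.range T, ∑ j ∈ Finset.range m,
            (P ^ (s + 1)) (position o x (j * T)) a + m * (m * T * β) := by
          rw [Finset.sum_add_distrib, Finset.sum_comm]
          simp
      _ ≤ ∑ s ∈ Finset.range T, σ + m * (m * T * β) := by
          refine add_le_add_left (Finset.sum_le_sum fun s _ => ?_) _
          rw [← Finset.sum_image (s := Finset.range m) (g := fun j => position o x (j * T))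
            (f := fun u => (P ^ (s + 1)) u a) (not_not.1 hx)]
          exact hσ _ _ _
      _ = T * (σ + m ^ 2 * β) := by simp; ring
  have hC : 0 ≤ T * (σ + m ^ 2 * β) := by
    have : 0 ≤ σ := by simpa using hσ 0 o ∅
    positivity
  have key : ∀ j ∈ Finset.range m, 1 / 2 ≤ walkExp P o (m * T) [] fun x =>
      (if B x then 1 else 0) + failure G o A x + β / 2 + if B x then 0 else
        ((A.queried (staircase G o x)).map fun a => ∑ s ∈ Finset.range ((m - j) * T),
          (P ^ (s + 1)) (position o x (j * T)) a).sum := by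
    intro j hj
    rw [Finset.mem_range] at hj
    have hm : m * T = j * T + (m - j) * T := by
      rw [← Nat.add_mul, Nat.add_sub_cancel' hj.le]
    rw [hm]
    refine half_le_walkExp hP G A B (j * T) ((m - j) * T) (hβ _ ?_)
    exact Nat.le_mul_of_pos_left _ (Nat.sub_pos_of_lt hj)
  have h1 := Finset.sum_le_sum key
  rw [← walkExp_sum] at h1
  calc (m : ℝ) / 2 = ∑ j ∈ Finset.range m, 1 / 2 := by simp; ring
    _ ≤ _ := h1
    _ ≤ walkExp P o (m * T) [] fun x => m * coll x + m * failure G o A x + m * (β / 2)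
        + T * (σ + m ^ 2 * β) * (A.numQueries (staircase G o x) : ℝ) := by
      refine walkExp_mono hP trivial fun x _ _ => ?_
      rw [List.append_nil]
      simp only [Finset.sum_add_distrib, Finset.sum_const, Finset.card_range, nsmul_eq_mul]
      refine add_le_add (add_le_add_left (add_le_add_left (mul_le_mul_of_nonneg_left (hBcoll x)
        (Nat.cast_nonneg m)) _) _) ?_
      by_cases hx : B x
      · simp only [hx, if_true, Finset.sum_const_zero]
        positivity
      · simp only [hx, if_false]
        rw [← A.length_queried]
        exact sum_list_map_sum_le _ _ _ (hvisit x hx)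
    _ ≤ _ := by
      simp only [walkExp_fun_add, walkExp_const_mul, walkExp_const hP]
      have := mul_le_mul_of_nonneg_left hcollE (Nat.cast_nonneg (α := ℝ) m)
      linarith

end Resampling

/-! ### Passage to randomized algorithms -/

section Randomized

variable {V : Type u}

theorem integrable_numQueries {μ : ProbabilityMeasure (QueryAlgorithm V)}
    (hμ : expectedQueries μ ≠ ⊤) (f : V → ℝ) :
    Integrable (fun A : QueryAlgorithm V => (A.numQueries f : ℝ))
      (μ : Measure (QueryAlgorithm V)) := by
  refine ⟨(measurable_from_nat.comp
    (QueryAlgorithm.measurable_numQueries f)).aestronglyMeasurable, ?_⟩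
  rw [hasFiniteIntegral_iff_ofReal (Filter.Eventually.of_forall fun _ => Nat.cast_nonneg _)]
  simp only [ENNReal.ofReal_natCast]
  exact lt_of_le_of_lt (le_iSup (fun f : V → ℝ =>
    ∫⁻ A, (A.numQueries f : ℝ≥0∞) ∂(μ : Measure (QueryAlgorithm V))) f) (lt_top_iff_ne_top.2 hμ)

theorem integral_numQueries_le {μ : ProbabilityMeasure (QueryAlgorithm V)}
    (hμ : expectedQueries μ ≠ ⊤) (f : V → ℝ) :
    ∫ A : QueryAlgorithm V, (A.numQueries f : ℝ) ∂(μ : Measure (QueryAlgorithm V))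
      ≤ (expectedQueries μ).toReal := by
  rw [integral_eq_lintegral_of_nonneg_ae (Filter.Eventually.of_forall fun _ => Nat.cast_nonneg _)
    (integrable_numQueries hμ f).1]
  simp only [ENNReal.ofReal_natCast]
  exact ENNReal.toReal_mono hμ (le_iSup (fun f : V → ℝ =>
    ∫⁻ A, (A.numQueries f : ℝ≥0∞) ∂(μ : Measure (QueryAlgorithm V))) f)

variable [Fintype V] [DecidableEq V] {P : Matrix V V ℝ} {o : V}

omit [Fintype V] in
theorem failure_eq_indicator (G : SimpleGraph V) (o : V) (x : List V) :
    (fun A => failure G o A x)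
      = {A : QueryAlgorithm V | A.result (staircase G o x) ∈ ({current o x} : Set V)ᶜ}.indicator
        1 := by
  ext A
  by_cases h : A.result (staircase G o x) = current o x <;> simp [failure, h]

omit [Fintype V] in
theorem integrable_failure (G : SimpleGraph V) (o : V) (x : List V)
    (μ : ProbabilityMeasure (QueryAlgorithm V)) :
    Integrable (fun A => failure G o A x) (μ : Measure (QueryAlgorithm V)) := by
  rw [failure_eq_indicator]
  exact (integrable_const (1 : ℝ)).indicator (QueryAlgorithm.measurableSet_result _ _)

/-- For a possible walk the endpoint is the only correct answer, so missing it is an error. -/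
theorem integral_failure_le {G : SimpleGraph V} (hG : G.Connected) (hP : IsChainOn G P)
    {μ : ProbabilityMeasure (QueryAlgorithm V)} (hμ : Solves G μ) {x : List V}
    (hx : IsPossible P o x) :
    ∫ A, failure G o A x ∂(μ : Measure (QueryAlgorithm V)) ≤ 1 / 10 := by
  rw [failure_eq_indicator, integral_indicator_one (QueryAlgorithm.measurableSet_result _ _)]
  have h1 : (9 / 10 : ℝ≥0∞) ≤ (μ : Measure (QueryAlgorithm V))
      {A : QueryAlgorithm V | A.result (staircase G o x) ∈ ({current o x} : Set V)} :=
    (hμ (staircase G o x)).trans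
      (measure_mono fun A hA => eq_current_of_isLocalMinimum hG hP hx hA)
  have h2 : (9 / 10 : ℝ) ≤ (μ : Measure (QueryAlgorithm V)).real
      {A : QueryAlgorithm V | A.result (staircase G o x) ∈ ({current o x} : Set V)} := by
    have := ENNReal.toReal_mono (measure_ne_top _ _) h1
    rw [ENNReal.toReal_div] at this
    simpa [measureReal_def] using this
  have h3 := probReal_compl_eq_one_sub (μ := (μ : Measure (QueryAlgorithm V)))
    (QueryAlgorithm.measurableSet_result (staircase G o x) ({current o x} : Set V))
  have h4 : {A : QueryAlgorithm V | A.result (staircase G o x) ∈ ({current o x} : Set V)}ᶜ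
      = {A : QueryAlgorithm V | A.result (staircase G o x) ∈ ({current o x} : Set V)ᶜ} := rfl
  rw [h4] at h3
  rw [h3]
  linarith

omit [DecidableEq V] in
theorem integrable_walkExp {Ω : Type*} [MeasurableSpace Ω] {μ : Measure Ω} {F : List V → Ω → ℝ}
    (hF : ∀ x, Integrable (F x) μ) (k : ℕ) (h : List V) :
    Integrable (fun ω => walkExp P o k h fun x => F x ω) μ := by
  induction k generalizing h with
  | zero => exact hF h
  | succ k ih => exact integrable_finsetSum _ fun v _ => (ih (v :: h)).const_mul _

omit [DecidableEq V] in
theorem integral_walkExp {Ω : Type*} [MeasurableSpace Ω] {μ : Measure Ω} {F : List V → Ω → ℝ}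
    (hF : ∀ x, Integrable (F x) μ) (k : ℕ) (h : List V) :
    ∫ ω, walkExp P o k h (fun x => F x ω) ∂μ = walkExp P o k h fun x => ∫ ω, F x ω ∂μ := by
  induction k generalizing h with
  | zero => rfl
  | succ k ih =>
    simp only [walkExp]
    rw [integral_finsetSum _ fun v _ => (integrable_walkExp hF k (v :: h)).const_mul _]
    simp only [integral_const_mul, ih]

/-- Average `milestones_le` over the algorithm and exchange with the finite walk expectation. Only
outputs and query counts, which are measurable by construction, enter here; the lists of queries do
not. -/
theorem milestones_le_expectedQueries {G : SimpleGraph V} (hG : G.Connected) (hP : IsChainOn G P)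
    [Nonempty V] {μ : ProbabilityMeasure (QueryAlgorithm V)} (hμ : Solves G μ)
    (hfin : expectedQueries μ ≠ ⊤) (m T : ℕ) {β σ : ℝ} (hβ0 : 0 ≤ β)
    (hβ : ∀ s, T ≤ s → ∀ u v, (P ^ s) u v ≤ β)
    (hσ : ∀ s a, ∀ S : Finset V, ∑ u ∈ S, (P ^ s) u a ≤ σ) :
    m / 2 ≤ m * (m ^ 2 * β + β / 2) + m * (1 / 10)
      + T * (σ + m ^ 2 * β) * (expectedQueries μ).toReal := by
  obtain ⟨o⟩ := ‹Nonempty V›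
  have hif := integrable_walkExp (P := P) (o := o) (μ := (μ : Measure (QueryAlgorithm V)))
    (F := fun x A => failure G o A x) (fun x => integrable_failure G o x μ) (m * T) []
  have hiq := integrable_walkExp (P := P) (o := o) (μ := (μ : Measure (QueryAlgorithm V)))
    (F := fun x A => (A.numQueries (staircase G o x) : ℝ))
    (fun x => integrable_numQueries hfin (staircase G o x)) (m * T) []
  have h1 := integral_mono (μ := (μ : Measure (QueryAlgorithm V))) (integrable_const _)
    (((integrable_const _).add (hif.const_mul _)).add (hiq.const_mul _))
    fun A => milestones_le (o := o) hP.1 G A m T hβ0 hβ hσ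
  rw [integral_const, integral_add' ((integrable_const _).add (hif.const_mul _)) (hiq.const_mul _),
    integral_add' (integrable_const _) (hif.const_mul _), integral_const, integral_const_mul,
    integral_const_mul, integral_walkExp (fun x => integrable_failure G o x μ),
    integral_walkExp (fun x => integrable_numQueries hfin (staircase G o x))] at h1
  simp only [probReal_univ, one_smul] at h1
  have hC : 0 ≤ T * (σ + m ^ 2 * β) := by
    have : 0 ≤ σ := by simpa using hσ 0 o ∅
    positivity
  refine h1.trans (add_le_add (add_le_add_right (mul_le_mul_of_nonneg_left ?_
    (Nat.cast_nonneg m)) _) (mul_le_mul_of_nonneg_left ?_ hC))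
  · rw [← walkExp_const (P := P) (o := o) hP.1 (m * T) [] (1 / 10)]
    refine walkExp_mono hP.1 trivial fun t _ ht => integral_failure_le hG hP hμ ht
  · rw [← walkExp_const (P := P) (o := o) hP.1 (m * T) [] (expectedQueries μ).toReal]
    exact walkExp_mono hP.1 trivial fun t _ _ => integral_numQueries_le hfin _

/-- Without a query, an algorithm cannot be right on two inputs without a common local minimum. -/
theorem four_fifths_le_expectedQueries {G : SimpleGraph V} (hG : G.Connected) (hP : IsChainOn G P)
    [Nontrivial V] {μ : ProbabilityMeasure (QueryAlgorithm V)} (hμ : Solves G μ)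
    (hfin : expectedQueries μ ≠ ⊤) : 4 / 5 ≤ (expectedQueries μ).toReal := by
  obtain ⟨u, v, huv⟩ := exists_pair_ne V
  have hiu := integrable_failure G u [] μ
  have hiv := integrable_failure G v [] μ
  have hiq := integrable_numQueries hfin (staircase G u [])
  have h1 := integral_mono (μ := (μ : Measure (QueryAlgorithm V))) (integrable_const 1)
    ((hiu.add hiv).add hiq) (by
      intro A
      simp only [Pi.add_apply]
      unfold failure
      have hq : (0 : ℝ) ≤ A.numQueries (staircase G u []) := Nat.cast_nonneg _
      by_cases h1 : A.result (staircase G u []) = current u []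
      · by_cases h2 : A.result (staircase G v []) = current v []
        · obtain ⟨a, ha, -⟩ := A.exists_mem_queried (staircase G u []) (staircase G v [])
            (by rw [h1, h2]; exact huv)
          have h3 : 1 ≤ A.numQueries (staircase G u []) := by
            rw [← A.length_queried]
            exact List.length_pos_of_mem ha
          have h4 : (1 : ℝ) ≤ A.numQueries (staircase G u []) := by exact_mod_cast h3
          rw [if_pos h1, if_pos h2]
          linarith
        · rw [if_pos h1, if_neg h2]
          linarith
      · rw [if_neg h1]
        split_ifs <;> linarith)
  rw [integral_const, integral_add' (hiu.add hiv) hiq, integral_add' hiu hiv, probReal_univ,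
    one_smul] at h1
  have h2 := integral_failure_le (o := u) (x := []) hG hP hμ trivial
  have h3 := integral_failure_le (o := v) (x := []) hG hP hμ trivial
  have h4 := integral_numQueries_le hfin (staircase G u [])
  linarith

end Randomized

/-- The choice of the number of milestones. -/
theorem sqrt_div_le_of_milestones {n σ T R : ℝ} (hn : 0 ≤ n) (hσ : 1 ≤ σ) (hT : 1 ≤ T)
    (hR : 4 / 5 ≤ R)
    (h : ∀ m : ℕ, m / 2 ≤ m * (m ^ 2 * (2 * σ / n) + 2 * σ / n / 2) + m * (1 / 10)
      + T * (σ + m ^ 2 * (2 * σ / n)) * R) :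
    1 / 56 * (√n / (T * Real.exp (3 * σ))) ≤ R := by
  have hexp : σ ^ 2 ≤ Real.exp (3 * σ) := by
    have h1 : σ ≤ Real.exp σ := by linarith [Real.add_one_le_exp σ]
    calc σ ^ 2 ≤ Real.exp σ ^ 2 := by gcongr
      _ = Real.exp (2 * σ) := by rw [← Real.exp_nat_mul]; norm_num
      _ ≤ _ := Real.exp_le_exp.2 (by linarith)
  have hE := Real.exp_pos (3 * σ)
  suffices H : √n ≤ 56 * (T * σ ^ 2 * R) by
    rw [one_div_mul_eq_div, div_div, div_le_iff₀ (by positivity)]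
    have : T * σ ^ 2 * R ≤ T * Real.exp (3 * σ) * R := by gcongr
    linarith
  have hTσ : 1 ≤ T * σ := one_le_mul_of_one_le_of_one_le hT hσ
  -- For small `n` no milestone fits, but then `√n ≤ 7σ` and the bound `4/5 ≤ R` suffices.
  rcases lt_or_ge n (40 * σ) with hlt | hge
  · have h1 : √n ≤ 7 * σ := Real.sqrt_le_iff.2 ⟨by linarith, by nlinarith⟩
    nlinarith [mul_le_mul hTσ hR (by norm_num) (by positivity)]
  · have hn0 : 0 < n := by linarith
    -- The number of milestones is `⌊z⌋₊`; the 40 makes `m²β ≤ 1/20`. The rational multiple `y` of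
    -- `√n` lies below `z` because `40σ ≤ 49σ²`.
    set y := √n / (7 * σ) with hy
    set z := √(n / (40 * σ)) with hz
    have hyz : y ≤ z := by
      rw [hy, hz]
      refine Real.le_sqrt_of_sq_le ?_
      rw [div_pow, Real.sq_sqrt hn]
      exact div_le_div_of_nonneg_left hn (by positivity) (by nlinarith)
    have hz1 : 1 ≤ z := Real.one_le_sqrt.2 ((one_le_div (by positivity)).2 hge)
    have hm1 : 1 ≤ ⌊z⌋₊ := Nat.le_floor (by simpa using hz1)
    have hmz : (⌊z⌋₊ : ℝ) ≤ z := Nat.floor_le (by positivity)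
    have hzm : z < ⌊z⌋₊ + 1 := Nat.lt_floor_add_one z
    have hm := h ⌊z⌋₊
    have hm1' : (1 : ℝ) ≤ ⌊z⌋₊ := by exact_mod_cast hm1
    set m : ℝ := (⌊z⌋₊ : ℝ)
    have hβ : m ^ 2 * (2 * σ / n) ≤ 1 / 20 := by
      calc m ^ 2 * (2 * σ / n) ≤ z ^ 2 * (2 * σ / n) := by gcongr
        _ = 1 / 20 := by
          rw [hz, Real.sq_sqrt (by positivity)]
          field_simp
          norm_num
    have hβ' : 2 * σ / n ≤ 1 / 20 := by
      rw [div_le_iff₀ hn0]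
      linarith
    have h1 : m * (m ^ 2 * (2 * σ / n) + 2 * σ / n / 2) ≤ m * (3 / 40) := by
      gcongr
      linarith
    have h2 : T * (σ + m ^ 2 * (2 * σ / n)) * R ≤ T * (21 / 20 * σ) * R := by
      gcongr
      linarith
    -- `1/2 - 1/10 - 3/40 = 13/40`, and `(21/20) / (13/40) = 42/13 ≤ 4`.
    have h3 : m ≤ 4 * (T * σ * R) := by nlinarith
    have h4 : √n = y * (7 * σ) := by rw [hy]; field_simp
    rw [h4]
    -- Here `y ≤ z < m + 1 ≤ 2m`, whence `56 = 2 · 4 · 7`.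
    calc y * (7 * σ) ≤ (8 * (T * σ * R)) * (7 * σ) := by
          gcongr
          linarith
      _ = _ := by ring

end LocalSearch

theorem theorem1 :
    ∃ c : ℝ, 0 < c ∧
      ∀ (V : Type u) [Fintype V] [DecidableEq V] (G : SimpleGraph V) (P : Matrix V V ℝ)
        (p : V → ℝ),
        2 ≤ Fintype.card V →
        G.Connected →
        LocalSearch.IsChainOn G P →
        LocalSearch.IsStationaryDistribution P p →
        LocalSearch.IsLazy P →
        LocalSearch.IsIrreducibleChain P →
        LocalSearch.IsReversible P p →
        ENNReal.ofReal
            (c * (√(Fintype.card V : ℝ) /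
              ((max 1 (LocalSearch.mixingTime P p
                  (LocalSearch.maxRatio p / (2 * (Fintype.card V : ℝ)))) : ℕ) *
                Real.exp (3 * LocalSearch.maxRatio p)))) ≤
          LocalSearch.randomizedQueryComplexity G := by
  refine ⟨1 / 56, by norm_num, ?_⟩
  intro V _ _ G P p hcard hG hP hp hlazy hirr hrev
  have : Nontrivial V := Fintype.one_lt_card_iff_nontrivial.1 hcard
  have hpos := LocalSearch.stationary_pos hP.1 hp hirr
  have hσ := LocalSearch.one_le_maxRatio hpos
  refine le_iInf₂ fun μ hμ => ?_
  by_cases hfin : LocalSearch.expectedQueries μ = ⊤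
  · rw [hfin]
    exact le_top
  refine ENNReal.ofReal_le_of_le_toReal ?_
  refine LocalSearch.sqrt_div_le_of_milestones (Nat.cast_nonneg _) hσ
    (by exact_mod_cast le_max_left _ _)
    (LocalSearch.four_fifths_le_expectedQueries hG hP hμ hfin) fun m => ?_
  refine LocalSearch.milestones_le_expectedQueries hG hP hμ hfin m _ (by positivity) ?_
    (LocalSearch.sum_pow_apply_le hP.1 hpos hrev)
  exact fun s hs => LocalSearch.pow_apply_le_of_mixingTime_le hP.1 hp hlazy hirr
    ((le_max_right _ _).trans hs)
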